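/- Theorem (Codimension formula). Let $\mathbb{K}$ be an infinite field with algebraic closure $\overline{\mathbb{K}}$, let $d \ge 1$ and $n_1,\dots,n_d,m \ge 0$ be integers, and let $F\colon \mathbb{K}^{n_1}\times\cdots\times\mathbb{K}^{n_d}\to\mathbb{K}^m$ be a multilinear map. Put \[ Z_F(\mathbb{K}) = \{(v_1,\dots,v_d)\in \mathbb{K}^{n_1}\times\cdots\times\mathbb{K}^{n_d} : F(v_1,\dots,v_d)=0\} \] and, for every integer $r \ge 0$, \[ W_{r,F}(\mathbb{K}) = \{(v_1,\dots,v_{d-1})\in \mathbb{K}^{n_1}\times\cdots\times\mathbb{K}^{n_{d-1}} : \operatorname{rank} F(v_1,\dots,v_{d-1},\cdot)=r\}, \] where $F(v_1,\dots,v_{d-1},\cdot)$ is regarded as a linear map $\mathbb{K}^{n_d}\to\mathbb{K}^m$. For $S\subseteq\mathbb{K}^N$ let $\overline{S}\subseteq\overline{\mathbb{K}}^N$ be the set of common zeros in $\overline{\mathbb{K}}^N$ of all polynomials in $\mathbb{K}[x_1,\dots,x_N]$ that vanish on $S$, and let $\operatorname{codim}\overline{S}=N-\dim\overline{S}$, where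 $\dim$ is the Krull dimension in the Zariski topology of $\overline{\mathbb{K}}^N$, with $\dim\varnothing=-\infty$ and so $\operatorname{codim}\varnothing=\infty$. Then \[ \operatorname{codim}\overline{Z_F(\mathbb{K})}=\min_{0\le r\le\min\{n_d,m\}}\bigl(r+\operatorname{codim}\overline{W_{r,F}(\mathbb{K})}\bigr). \] The codimension on the left is taken in $\overline{\mathbb{K}}^{n_1+\cdots+n_d}$ and those on the right in $\overline{\mathbb{K}}^{n_1+\cdots+n_{d-1}}$. -/

import Mathlib

namespace MultilinearVariety

/-- The Zariski topology on the affine space `L ^ σ`: the closed sets are the common zero loci of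
ideals of polynomials with coefficients in `L`. -/
abbrev zariskiTopology (σ L : Type*) [Field L] : TopologicalSpace (σ → L) :=
  TopologicalSpace.ofClosed
    {Z | ∃ I : Ideal (MvPolynomial σ L), Z = MvPolynomial.zeroLocus L I}
    ⟨⊤, by simp⟩
    (by
      intro A hA
      have hA' : ∀ Z, ∃ I : Ideal (MvPolynomial σ L), Z ∈ A → Z = MvPolynomial.zeroLocus L I :=
        fun Z => by
          by_cases hZ : Z ∈ A
          · obtain ⟨I, hI⟩ := hA hZ
            exact ⟨I, fun _ => hI⟩
          · exact ⟨⊤, fun h => absurd h hZ⟩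
      choose I hI using hA'
      refine ⟨⨆ Z ∈ A, I Z, Set.Subset.antisymm ?_ ?_⟩
      · intro x hx
        have h : (⨆ Z ∈ A, I Z) ≤ MvPolynomial.vanishingIdeal L {x} := by
          refine iSup₂_le fun Z hZ p hp => ?_
          have hxZ : x ∈ MvPolynomial.zeroLocus L (I Z) := by rw [← hI Z hZ]; exact hx Z hZ
          exact (MvPolynomial.mem_vanishingIdeal_singleton_iff x p).2 (hxZ p hp)
        exact fun p hp => (MvPolynomial.mem_vanishingIdeal_singleton_iff x p).1 (h hp)
      · intro x hx Z hZ
        rw [hI Z hZ]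
        exact fun p hp => hx p (le_iSup₂ (f := fun Z (_ : Z ∈ A) => I Z) Z hZ hp))
    (by
      rintro _ ⟨I, rfl⟩ _ ⟨J, rfl⟩
      refine ⟨I * J, Set.Subset.antisymm ?_ ?_⟩
      · rintro x (hx | hx)
        · exact MvPolynomial.zeroLocus_anti_mono Ideal.mul_le_left hx
        · exact MvPolynomial.zeroLocus_anti_mono Ideal.mul_le_right hx
      · intro x hx
        by_contra hcon
        simp only [Set.mem_union, not_or, MvPolynomial.mem_zeroLocus_iff, not_forall] at hcon
        obtain ⟨⟨p, hp, hp0⟩, q, hq, hq0⟩ := hcon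
        have h := hx (p * q) (Ideal.mul_mem_mul hp hq)
        rw [map_mul] at h
        exact (mul_ne_zero hp0 hq0) h)

theorem isClosed_zariskiTopology_iff {σ L : Type*} [Field L] {Z : Set (σ → L)} :
    @IsClosed _ (zariskiTopology σ L) Z ↔
      ∃ I : Ideal (MvPolynomial σ L), Z = MvPolynomial.zeroLocus L I := by
  rw [← @isOpen_compl_iff _ _ (zariskiTopology σ L)]
  change Zᶜᶜ ∈ {Z | ∃ I : Ideal (MvPolynomial σ L), Z = MvPolynomial.zeroLocus L I} ↔ _
  rw [compl_compl]
  rfl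

/-- The closure in `L ^ σ` of a set `S` of `K`-rational points: the common zeros in `L ^ σ` of all
polynomials with coefficients in `K` that vanish on `S`. -/
def closureOver {σ K : Type*} [Field K] (L : Type*) [Field L] [Algebra K L]
    (S : Set (σ → K)) : Set (σ → L) :=
  MvPolynomial.zeroLocus L (MvPolynomial.vanishingIdeal K S)

/-- The dimension of a subset of the affine space `L ^ σ`: its Krull dimension (supremum of the
lengths of chains of irreducible closed subsets) in the Zariski topology. It is `⊥`, that is `-∞`,
for the empty set. -/
noncomputable def dim {σ L : Type*} [Field L] (Y : Set (σ → L)) : WithBot ℕ∞ :=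
  letI := zariskiTopology σ L
  topologicalKrullDim Y

/-- The dimension never exceeds that of the ambient space, so that the subtraction in `codim`
below is not truncated. -/
theorem dim_le_card {σ L : Type*} [Fintype σ] [Field L] (Y : Set (σ → L)) :
    dim Y ≤ ((Fintype.card σ : ℕ∞) : WithBot ℕ∞) := by
  let _ := zariskiTopology σ L
  have hind : Topology.IsInducing
      (MvPolynomial.pointToPoint : (σ → L) → PrimeSpectrum (MvPolynomial σ L)) := by
    refine ⟨TopologicalSpace.ext_isClosed fun Z => ?_⟩
    rw [isClosed_zariskiTopology_iff, isClosed_induced_iff]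
    have key : ∀ I : Ideal (MvPolynomial σ L),
        (MvPolynomial.pointToPoint : (σ → L) → PrimeSpectrum (MvPolynomial σ L)) ⁻¹'
          PrimeSpectrum.zeroLocus (I : Set (MvPolynomial σ L)) = MvPolynomial.zeroLocus L I := by
      intro I
      ext x
      rw [Set.mem_preimage, PrimeSpectrum.mem_zeroLocus]
      exact forall₂_congr fun p _ => MvPolynomial.mem_vanishingIdeal_singleton_iff x p
    constructor
    · rintro ⟨I, rfl⟩
      exact ⟨_, PrimeSpectrum.isClosed_zeroLocus _, key I⟩
    · rintro ⟨T, hT, rfl⟩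
      obtain ⟨I, rfl⟩ := (PrimeSpectrum.isClosed_iff_zeroLocus_ideal T).1 hT
      exact ⟨I, key I⟩
  calc dim Y ≤ topologicalKrullDim (σ → L) := topologicalKrullDim_subspace_le _ Y
    _ ≤ topologicalKrullDim (PrimeSpectrum (MvPolynomial σ L)) := hind.topologicalKrullDim_le
    _ = _ := by
      rw [PrimeSpectrum.topologicalKrullDim_eq_ringKrullDim,
        MvPolynomial.ringKrullDim_of_isNoetherianRing, ringKrullDim_eq_zero_of_field]
      simp

/-- The codimension in the affine space `L ^ σ` of a subset `Y`: the number of coordinates minus the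
dimension of `Y`. As usual, it is infinite for the empty set, whose dimension is `-∞`. -/
noncomputable def codim {σ L : Type*} [Fintype σ] [Field L] (Y : Set (σ → L)) : ℕ∞ :=
  WithBot.recBotCoe ⊤ (fun k : ℕ∞ => (Fintype.card σ : ℕ∞) - k) (dim Y)

/-- The identification of `K ^ n₁ × ⋯ × K ^ n_d` with the affine space `K ^ (n₁ + ⋯ + n_d)`, whose
coordinates are indexed by the pairs `(i, j)` with `j < n i`. -/
def flatten {ι K : Type*} {n : ι → ℕ} (v : ∀ i, Fin (n i) → K) : (Σ i, Fin (n i)) → K :=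
  fun p => v p.1 p.2

/-- The set `Z_F(K)` of zeros of a multilinear map, in the affine space `K ^ (n₁ + ⋯ + n_d)`. -/
def zeroSet {K : Type*} [Field K] {ι : Type*} {n : ι → ℕ} {m : ℕ}
    (F : MultilinearMap K (fun i => Fin (n i) → K) (Fin m → K)) :
    Set ((Σ i, Fin (n i)) → K) :=
  flatten '' {v | F v = 0}

/-- The set `W_{r,F}(K)` of the tuples `v` of vectors in all factors but the last for which the
linear map `F(v, ·)` in the last variable has rank `r`. -/
def rankSet {K : Type*} [Field K] {d : ℕ} {n : Fin (d + 1) → ℕ} {m : ℕ}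
    (F : MultilinearMap K (fun i => Fin (n i) → K) (Fin m → K)) (r : ℕ) :
    Set ((Σ i : Fin d, Fin (n i.castSucc)) → K) :=
  flatten '' {v | Module.finrank K (LinearMap.range (F.curryRight v)) = r}

end MultilinearVariety

/-!
The dimension of the closure of a set `S` of `K`-rational points is the Krull dimension of the ring
`K[x] / I(S)` of polynomial functions on `S` (`dim_closureOver`): over the algebraic closure the
dimension of a zero locus is that of its coordinate ring, by the Nullstellensatz, and passing from
`K[x] / I(S)` to the coordinate ring over the algebraic closure is an integral extension. Call this
dimension `pointsDim S`. It can be handled without leaving `K`: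

* the dimension of a finite union is attained by one of its members
  (`exists_pointsDim_iUnion_le`);
* it does not increase under polynomial maps (`pointsDim_image_le`), because a subalgebra
  of a finitely generated algebra over a field, if itself finitely generated, has at most its
  dimension (`ringKrullDim_le_of_injective`);
* multiplying by `K ^ s` raises it by `s` (`pointsDim_cylinder`); here `K` has to be infinite.

Let `N` be the number of coordinates of the last factor. The set of `v` for which `F(v, ·)` has rank
`r` is the union of its pieces on which a given minor of size `r` does not vanish. On such a piece
Cramer's rule, with denominators cleared, parametrizes the kernels polynomially by `K ^ (N - r)`
(`kernelParam`). So the zeros of `F` over the piece are the image of the product of the piece with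
`K ^ (N - r)` under a polynomial map, and forgetting coordinates maps them back onto that product.
Both dimensions therefore agree (`pointsDim_zeroPiece`), and the dimension of the zero set is the
maximum over `r` of the dimension of the rank locus plus `N - r`. Subtracting from the number of
coordinates gives the formula.
-/

namespace MultilinearVariety

open MvPolynomial Topology

/-! ### Krull dimension of finitely generated algebras -/

theorem ringKrullDim_le_of_isIntegral {A B : Type*} [CommRing A] [CommRing B] {f : A →+* B}
    (hf : f.IsIntegral) : ringKrullDim B ≤ ringKrullDim A := by
  algebraize [f]
  refine Order.krullDim_le_of_strictMono (PrimeSpectrum.comap (algebraMap A B)) fun p q hpq => ?_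
  exact Ideal.IsIntegral.comap_lt_comap (I := p.asIdeal) (J := q.asIdeal) hpq

theorem ringKrullDim_le_of_isIntegral_of_injective {A B : Type*} [CommRing A] [CommRing B]
    {f : A →+* B} (hf : f.IsIntegral) (hinj : Function.Injective f) :
    ringKrullDim A ≤ ringKrullDim B := by
  algebraize [f]
  refine iSup_le fun l => ?_
  obtain ⟨P, -, hP, hover⟩ := Ideal.exists_ideal_over_prime_of_isIntegral
    l.head.asIdeal (⊥ : Ideal B)
    (((RingHom.injective_iff_ker_eq_bot _).1 hinj).trans_le bot_le)
  have : P.LiesOver l.head.asIdeal := ⟨hover.symm⟩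
  obtain ⟨l', hlen, -, -⟩ := Ideal.exists_ltSeries_of_hasGoingUp l P
  rw [← hlen]
  exact Order.LTSeries.length_le_krullDim l'

/-- A domain that is integral over the image of a polynomial ring in `t` variables has
transcendence degree at most `t`, so that it contains no polynomial ring in more variables. -/
theorem le_of_injective_of_isIntegral {K B : Type*} [Field K] [CommRing B] [IsDomain B]
    [Algebra K B] {s t : ℕ} {h : MvPolynomial (Fin s) K →ₐ[K] B} (hh : Function.Injective h)
    {g : MvPolynomial (Fin t) K →ₐ[K] B} (hg : g.IsIntegral) : s ≤ t := by
  let x : Fin t → B := fun i => g (X i)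
  have hgx : g = aeval x := by ext i; simp [x]
  have hind : AlgebraicIndependent K fun i : Fin s => h (X i) := by
    have : h = aeval fun i : Fin s => h (X i) := by ext i; simp
    rw [AlgebraicIndependent, ← this]
    exact hh
  have halg : Algebra.IsAlgebraic (Algebra.adjoin K (Set.range x)) B := by
    have : Algebra.IsIntegral (Algebra.adjoin K (Set.range x)) B := by
      refine ⟨fun b => ?_⟩
      obtain ⟨p, hp, hpb⟩ := hg b
      have hmem : ∀ q, g q ∈ Algebra.adjoin K (Set.range x) := fun q => by
        rw [Algebra.adjoin_range_eq_range_aeval, hgx]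
        exact ⟨q, rfl⟩
      refine ⟨p.map (g.codRestrict _ hmem).toRingHom, hp.map _, ?_⟩
      rw [Polynomial.eval₂_map]
      exact hpb
    infer_instance
  have h1 := hind.lift_cardinalMk_le_trdeg
  have h2 := Algebra.IsAlgebraic.trdeg_le_cardinalMk K (Set.range x)
  have h3 := Cardinal.mk_range_le_lift (f := x)
  have h4 := (Cardinal.lift_le.2 h2).trans h3
  simp only [Cardinal.mk_fin, Cardinal.lift_natCast, Cardinal.lift_id'] at *
  exact_mod_cast h1.trans h4

/-- The dimension of finitely generated algebras over a field is monotone under injections. This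
fails for general rings; here it amounts to monotonicity of the transcendence degree. -/
theorem ringKrullDim_le_of_injective {K A B : Type*} [Field K] [CommRing A] [CommRing B]
    [Algebra K A] [Algebra K B] [Algebra.FiniteType K A] [Algebra.FiniteType K B]
    {f : A →ₐ[K] B} (hf : Function.Injective f) : ringKrullDim A ≤ ringKrullDim B := by
  cases subsingleton_or_nontrivial A
  · rw [ringKrullDim_eq_bot_of_subsingleton]
    exact bot_le
  obtain ⟨s, g, hg, hgi⟩ := exists_integral_inj_algHom_of_fg K A
  -- Some prime `q` of `B` lies over the zero ideal of the polynomial ring.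
  obtain ⟨q, hq, hq0⟩ := Ideal.exists_comap_eq_of_mem_minimalPrimes_of_injective
    (f := (f.comp g).toRingHom) (hf.comp hg) ⊥
    (by rw [IsDomain.minimalPrimes_eq_singleton_bot]; rfl)
  have hinj : Function.Injective ((Ideal.Quotient.mkₐ K q).comp (f.comp g)) := by
    rw [injective_iff_map_eq_zero]
    intro a ha
    have : a ∈ q.comap (f.comp g).toRingHom :=
      (Ideal.Quotient.eq_zero_iff_mem (I := q)).1 ha
    rwa [hq0] at this
  obtain ⟨t, g', hg', hgi'⟩ := exists_integral_inj_algHom_of_fg K (B ⧸ q)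
  calc ringKrullDim A ≤ ringKrullDim (MvPolynomial (Fin s) K) := ringKrullDim_le_of_isIntegral hgi
    _ = s := by simp
    _ ≤ t := by exact_mod_cast le_of_injective_of_isIntegral hinj hgi'
    _ = ringKrullDim (MvPolynomial (Fin t) K) := by simp
    _ ≤ ringKrullDim (B ⧸ q) := ringKrullDim_le_of_isIntegral_of_injective hgi' hg'
    _ ≤ ringKrullDim B := ringKrullDim_quotient_le q

/-- A chain of primes containing a finite intersection of ideals has its smallest member, and hence
all its members, over one of these ideals. -/
theorem exists_ringKrullDim_quotient_iInf_le {R ι : Type*} [CommRing R] [Finite ι] [Nonempty ι]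
    (I : ι → Ideal R) : ∃ i, ringKrullDim (R ⧸ ⨅ i, I i) ≤ ringKrullDim (R ⧸ I i) := by
  obtain ⟨i, hi⟩ := Finite.exists_max fun i => ringKrullDim (R ⧸ I i)
  refine ⟨i, ?_⟩
  rw [ringKrullDim_quotient]
  refine iSup_le fun l => ?_
  obtain ⟨j, hj⟩ : ∃ j, I j ≤ l.head.1.asIdeal := by
    have := Fintype.ofFinite ι
    have h : Finset.univ.inf I ≤ l.head.1.asIdeal := by
      rw [Finset.inf_univ_eq_iInf]
      exact l.head.2
    obtain ⟨j, -, hj⟩ := (l.head.1.2.inf_le').1 h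
    exact ⟨j, hj⟩
  refine le_trans ?_ (hi j)
  rw [ringKrullDim_quotient]
  let l' : LTSeries (PrimeSpectrum.zeroLocus (I j : Set R)) :=
    { length := l.length
      toFun := fun k => ⟨(l k).1, hj.trans (l.head_le k)⟩
      step := fun k => l.step k }
  exact Order.LTSeries.length_le_krullDim l'

/-! ### Dimension of zero loci -/

theorem isInducing_pointToPoint (σ L : Type*) [Field L] :
    @IsInducing _ _ (zariskiTopology σ L) _
      (pointToPoint : (σ → L) → PrimeSpectrum (MvPolynomial σ L)) := by
  let _ := zariskiTopology σ L
  have key : ∀ I : Ideal (MvPolynomial σ L),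
      (pointToPoint : (σ → L) → PrimeSpectrum (MvPolynomial σ L)) ⁻¹'
        PrimeSpectrum.zeroLocus (I : Set (MvPolynomial σ L)) = zeroLocus L I := by
    intro I
    ext x
    exact forall₂_congr fun p _ => mem_vanishingIdeal_singleton_iff x p
  refine ⟨TopologicalSpace.ext_isClosed fun Z => ?_⟩
  rw [isClosed_zariskiTopology_iff, isClosed_induced_iff]
  constructor
  · rintro ⟨I, rfl⟩
    exact ⟨_, PrimeSpectrum.isClosed_zeroLocus _, key I⟩
  · rintro ⟨T, hT, rfl⟩
    obtain ⟨I, rfl⟩ := (PrimeSpectrum.isClosed_iff_zeroLocus_ideal T).1 hT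
    exact ⟨I, key I⟩

theorem isIrreducible_of_image {X Y : Type*} [TopologicalSpace X] [TopologicalSpace Y] {f : Y → X}
    (hf : IsInducing f) {s : Set Y} (hs : IsIrreducible (f '' s)) : IsIrreducible s := by
  refine ⟨Set.image_nonempty.1 hs.1, fun u v hu hv => ?_⟩
  obtain ⟨u, hu', rfl⟩ := hf.isOpen_iff.1 hu
  obtain ⟨v, hv', rfl⟩ := hf.isOpen_iff.1 hv
  simpa [Set.Nonempty] using hs.2 u v hu' hv'

theorem isIrreducible_zeroLocus {σ L : Type*} [Finite σ] [Field L] [IsAlgClosed L]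
    (P : Ideal (MvPolynomial σ L)) [hP : P.IsPrime] :
    @IsIrreducible _ (zariskiTopology σ L) (zeroLocus L P) := by
  let _ := zariskiTopology σ L
  have hvan := IsPrime.vanishingIdeal_zeroLocus (K := L) P
  refine ⟨?_, ?_⟩
  · rw [Set.nonempty_iff_ne_empty]
    intro h
    rw [h, vanishingIdeal_empty] at hvan
    exact hP.ne_top hvan.symm
  · rw [isPreirreducible_iff_isClosed_union_isClosed]
    intro Z₁ Z₂ h₁ h₂ hsub
    obtain ⟨I₁, rfl⟩ := isClosed_zariskiTopology_iff.1 h₁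
    obtain ⟨I₂, rfl⟩ := isClosed_zariskiTopology_iff.1 h₂
    change zeroLocus L P ≤ zeroLocus L I₁ ∨ zeroLocus L P ≤ zeroLocus L I₂
    rw [le_zeroLocus_iff_le_vanishingIdeal,
      le_zeroLocus_iff_le_vanishingIdeal, hvan, ← hP.mul_le]
    refine Ideal.mul_le.2 fun f hf g hg => ?_
    rw [← hvan]
    intro x hx
    rw [map_mul]
    rcases hsub hx with h | h
    · rw [h f hf, zero_mul]
    · rw [h g hg, mul_zero]

/-- Over an algebraically closed field, the dimension of a zero locus is that of its coordinate
ring. -/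
theorem dim_zeroLocus {σ L : Type*} [Finite σ] [Field L] [IsAlgClosed L]
    (J : Ideal (MvPolynomial σ L)) :
    dim (zeroLocus L J) = ringKrullDim (MvPolynomial σ L ⧸ J) := by
  let _ := zariskiTopology σ L
  change topologicalKrullDim (zeroLocus L J) = _
  apply le_antisymm
  -- The zero locus is a subspace of the prime spectrum of the coordinate ring.
  · have hmk := PrimeSpectrum.isClosedEmbedding_comap_of_surjective _ (Ideal.Quotient.mk J)
      Ideal.Quotient.mk_surjective
    have hex : ∀ y : zeroLocus L J, ∃ q : PrimeSpectrum (MvPolynomial σ L ⧸ J),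
        PrimeSpectrum.comap (Ideal.Quotient.mk J) q = pointToPoint y.1 := by
      intro y
      change pointToPoint y.1 ∈ Set.range _
      rw [range_comap_of_surjective _ _ Ideal.Quotient.mk_surjective, Ideal.mk_ker]
      exact pointToPoint_zeroLocus_le J ⟨y.1, y.2, rfl⟩
    choose g hg using hex
    have hcomp : PrimeSpectrum.comap (Ideal.Quotient.mk J) ∘ g = pointToPoint ∘ Subtype.val :=
      funext hg
    have hind : IsInducing g := by
      rw [← hmk.isInducing.of_comp_iff, hcomp]
      exact (isInducing_pointToPoint σ L).comp IsInducing.subtypeVal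
    rw [← PrimeSpectrum.topologicalKrullDim_eq_ringKrullDim]
    exact hind.topologicalKrullDim_le
  -- A prime is recovered from the irreducible closed set that it cuts out, by the Nullstellensatz.
  · rw [ringKrullDim, ← Order.krullDim_orderDual]
    have hJ : ∀ q : PrimeSpectrum (MvPolynomial σ L ⧸ J),
        J ≤ q.asIdeal.comap (Ideal.Quotient.mk J) := fun q x hx => by
      rw [Ideal.mem_comap, Ideal.Quotient.eq_zero_iff_mem.2 hx]
      exact zero_mem _
    have himg : ∀ q : PrimeSpectrum (MvPolynomial σ L ⧸ J),
        Subtype.val '' ((Subtype.val : zeroLocus L J → σ → L) ⁻¹'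
          zeroLocus L (q.asIdeal.comap (Ideal.Quotient.mk J))) =
        zeroLocus L (q.asIdeal.comap (Ideal.Quotient.mk J)) := fun q => by
      rw [Subtype.image_preimage_coe, Set.inter_eq_right]
      exact zeroLocus_anti_mono (hJ q)
    let f : (PrimeSpectrum (MvPolynomial σ L ⧸ J))ᵒᵈ →
        TopologicalSpace.IrreducibleCloseds (zeroLocus L J) := fun q =>
      { carrier := Subtype.val ⁻¹'
          zeroLocus L ((OrderDual.ofDual q).asIdeal.comap (Ideal.Quotient.mk J))
        isIrreducible' := by
          apply isIrreducible_of_image IsInducing.subtypeVal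
          rw [himg]
          exact isIrreducible_zeroLocus _
        isClosed' := (isClosed_zariskiTopology_iff.2 ⟨_, rfl⟩).preimage continuous_subtype_val }
    refine Order.krullDim_le_of_strictMono f (Monotone.strictMono_of_injective ?_ ?_)
    · intro p q hpq
      exact Set.preimage_mono (f := Subtype.val)
        (zeroLocus_anti_mono (Ideal.comap_mono (OrderDual.ofDual_le_ofDual.2 hpq)))
    · intro p q hpq
      have h := congrArg (fun Z : TopologicalSpace.IrreducibleCloseds (zeroLocus L J) =>
        vanishingIdeal L (Subtype.val '' (Z : Set (zeroLocus L J)))) hpq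
      change vanishingIdeal L (Subtype.val '' (Subtype.val ⁻¹'
          zeroLocus L ((OrderDual.ofDual p).asIdeal.comap (Ideal.Quotient.mk J)))) =
        vanishingIdeal L (Subtype.val '' (Subtype.val ⁻¹'
          zeroLocus L ((OrderDual.ofDual q).asIdeal.comap (Ideal.Quotient.mk J)))) at h
      rw [himg, himg, IsPrime.vanishingIdeal_zeroLocus, IsPrime.vanishingIdeal_zeroLocus] at h
      exact PrimeSpectrum.ext
        (Ideal.comap_injective_of_surjective _ Ideal.Quotient.mk_surjective h)

attribute [local instance] algebraMvPolynomial in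
/-- The coordinate ring over `L` is integral over the one over `K`, and contains it because `L[x]` is
free over `K[x]`. -/
theorem ringKrullDim_quotient_map_algebraMap {σ K L : Type*} [Field K] [Field L] [Algebra K L]
    [Algebra.IsAlgebraic K L] (I : Ideal (MvPolynomial σ K)) :
    ringKrullDim (MvPolynomial σ L ⧸ I.map (map (algebraMap K L))) =
      ringKrullDim (MvPolynomial σ K ⧸ I) := by
  have : Module.Free (MvPolynomial σ K) (MvPolynomial σ L) :=
    Module.Free.of_equiv
      (Algebra.IsPushout.equiv K (MvPolynomial σ K) L (MvPolynomial σ L)).toLinearEquiv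
  have hcomap : (I.map (map (algebraMap K L))).comap (map (algebraMap K L)) = I :=
    I.comap_map_eq_self_of_faithfullyFlat (B := MvPolynomial σ L)
  let f := Ideal.quotientMap (I.map (map (algebraMap K L))) (map (algebraMap K L)) hcomap.ge
  have hinj : Function.Injective f := Ideal.quotientMap_injective' hcomap.le
  have hint : f.IsIntegral := by
    have h : (algebraMap (MvPolynomial σ K) (MvPolynomial σ L)).IsIntegral :=
      algebraMap_isIntegral_iff.2 inferInstance
    refine RingHom.IsIntegral.tower_top (Ideal.Quotient.mk I) f ?_
    rw [Ideal.quotientMap_comp_mk]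
    exact h.trans _ _ (RingHom.isIntegral_of_surjective _ Ideal.Quotient.mk_surjective)
  exact le_antisymm (ringKrullDim_le_of_isIntegral hint)
    (ringKrullDim_le_of_isIntegral_of_injective hint hinj)

/-- The dimension of the closure over the algebraic closure is computed by the ring of polynomial
functions over the base field. -/
theorem dim_closureOver {σ K : Type*} [Finite σ] [Field K] (S : Set (σ → K)) :
    dim (closureOver (AlgebraicClosure K) S) =
      ringKrullDim (MvPolynomial σ K ⧸ vanishingIdeal K S) := by
  have h : closureOver (AlgebraicClosure K) S = zeroLocus (AlgebraicClosure K)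
      ((vanishingIdeal K S).map (map (algebraMap K (AlgebraicClosure K)))) := by
    ext x
    rw [Ideal.map, zeroLocus_span]
    refine Iff.trans ?_ Set.forall_mem_image.symm
    simp only [aeval_map_algebraMap]
    rfl
  rw [h, dim_zeroLocus, ringKrullDim_quotient_map_algebraMap]

/-! ### Dimension of sets of rational points -/

/-- The dimension of a set `S` of rational points: the Krull dimension of the ring of polynomial
functions on `S`. It is `⊥` for the empty set. -/
noncomputable def pointsDim {σ K : Type*} [Field K] (S : Set (σ → K)) : WithBot ℕ∞ :=
  ringKrullDim (MvPolynomial σ K ⧸ vanishingIdeal K S)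

theorem exists_pointsDim_iUnion_le {σ K ι : Type*} [Field K] [Finite ι] [Nonempty ι]
    (S : ι → Set (σ → K)) : ∃ i, pointsDim (⋃ i, S i) ≤ pointsDim (S i) := by
  have h : vanishingIdeal K (⋃ i, S i) = ⨅ i, vanishingIdeal K (S i) := by
    ext p
    simp only [Ideal.mem_iInf, mem_vanishingIdeal_iff, Set.mem_iUnion]
    exact ⟨fun h i x hx => h x ⟨i, hx⟩, fun h x ⟨i, hx⟩ => h i x hx⟩
  unfold pointsDim
  rw [h]
  exact exists_ringKrullDim_quotient_iInf_le _

theorem pointsDim_mono {σ K : Type*} [Field K] {S T : Set (σ → K)} (h : S ⊆ T) :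
    pointsDim S ≤ pointsDim T :=
  ringKrullDim_le_of_surjective (Ideal.Quotient.factor (vanishingIdeal_anti_mono h))
    (Ideal.Quotient.factor_surjective _)

/-- A polynomial map does not raise dimensions: pulling functions back embeds the ring of functions
on the image into that of functions on the source. -/
theorem pointsDim_image_le {σ τ K : Type*} [Finite σ] [Finite τ] [Field K] (S : Set (σ → K))
    (φ : τ → MvPolynomial σ K) :
    pointsDim ((fun x t => eval x (φ t)) '' S) ≤ pointsDim S := by
  set T := (fun x t => eval x (φ t)) '' S
  have heval : ∀ (x : σ → K) (p : MvPolynomial τ K),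
      eval x (bind₁ φ p) = eval (fun t => eval x (φ t)) p := fun x p => by
    simp only [← aeval_eq_eval, aeval_bind₁]
  have hcomap : vanishingIdeal K T = (vanishingIdeal K S).comap (bind₁ φ) := by
    ext p
    simp only [T, Ideal.mem_comap, mem_vanishingIdeal_iff, Set.forall_mem_image, aeval_eq_eval,
      heval]
  have hinj : Function.Injective (Ideal.quotientMapₐ (vanishingIdeal K S) (bind₁ φ) hcomap.le) :=
    Ideal.quotientMap_injective' (H := hcomap.le) hcomap.ge
  exact ringKrullDim_le_of_injective hinj

/-- The set `K ^ ε × S`, with coordinates indexed by `ε ⊕ σ`. -/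
def cylinder {σ K : Type*} (ε : Type*) (S : Set (σ → K)) : Set (ε ⊕ σ → K) :=
  {x | x ∘ Sum.inr ∈ S}

theorem pointsDim_cylinder {σ ε K : Type*} [Finite σ] [Finite ε] [Field K] [Infinite K]
    (S : Set (σ → K)) : pointsDim (cylinder ε S) = pointsDim S + Nat.card ε := by
  let f : MvPolynomial (ε ⊕ σ) K →+* MvPolynomial ε (MvPolynomial σ K ⧸ vanishingIdeal K S) :=
    (map (Ideal.Quotient.mk _)).comp (sumAlgEquiv K ε σ : _ →+* _)
  have hf : Function.Surjective f :=
    (map_surjective _ Ideal.Quotient.mk_surjective).comp (sumAlgEquiv K ε σ).surjective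
  have heval : ∀ (p : MvPolynomial (ε ⊕ σ) K) (x : ε ⊕ σ → K),
      eval x p = eval (x ∘ Sum.inl) (map (eval (x ∘ Sum.inr)) (sumAlgEquiv K ε σ p)) := by
    intro p x
    induction p using MvPolynomial.induction_on with
    | C a => simp
    | add p q hp hq => simp [hp, hq]
    | mul_X p i hp => cases i <;> simp [hp]
  have hker : RingHom.ker f = vanishingIdeal K (cylinder ε S) := by
    ext p
    have h1 : p ∈ RingHom.ker f ↔
        ∀ e, coeff e (sumAlgEquiv K ε σ p) ∈ vanishingIdeal K S := by
      rw [RingHom.mem_ker]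
      simp only [← Ideal.Quotient.eq_zero_iff_mem, ← coeff_map]
      exact MvPolynomial.eq_zero_iff (p := f p)
    rw [h1]
    constructor
    · intro h x hx
      have h0 : map (eval (x ∘ Sum.inr)) (sumAlgEquiv K ε σ p) = 0 := by
        ext e
        rw [coeff_map, coeff_zero]
        exact h e _ hx
      rw [aeval_eq_eval, heval, h0, map_zero]
    · intro h e s hs
      -- As `K` is infinite, a polynomial that vanishes on all of `K ^ ε` has zero coefficients.
      have h0 : map (eval s) (sumAlgEquiv K ε σ p) = 0 := by
        refine MvPolynomial.funext fun y => ?_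
        have := h (Sum.elim y s) (by simpa [cylinder] using hs)
        rwa [aeval_eq_eval, heval, Sum.elim_comp_inl, Sum.elim_comp_inr] at this
      rw [aeval_eq_eval, ← coeff_map, h0, coeff_zero]
  unfold pointsDim
  rw [← hker, ringKrullDim_eq_of_ringEquiv (RingHom.quotientKerEquivOfSurjective hf),
    MvPolynomial.ringKrullDim_of_isNoetherianRing]

/-! ### Kernels of matrices of given rank -/

open Matrix

theorem exists_linearIndependent_rows {K : Type*} [Field K] {p q r : ℕ}
    {M : Matrix (Fin p) (Fin q) K} (h : M.rank = r) :
    ∃ a : Fin r → Fin p, LinearIndependent K (M.submatrix a id).row := by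
  obtain ⟨κ, a, ha, hspan, hli⟩ := exists_linearIndependent' K M.row
  have := Finite.of_injective a ha
  have := Fintype.ofFinite κ
  have hcard : Fintype.card κ = r := by
    rw [← h, Matrix.rank_eq_finrank_span_row, ← hspan, finrank_span_eq_card hli]
  let g := (Fintype.equivFinOfCardEq hcard).symm
  exact ⟨a ∘ g, hli.comp g g.injective⟩

theorem exists_equiv_sum_comp_inl {n r : ℕ} {b : Fin r → Fin n} (hb : Function.Injective b) :
    ∃ e : Fin r ⊕ Fin (n - r) ≃ Fin n, e ∘ Sum.inl = b := by
  classical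
  have hcard : Fintype.card ↥(Set.range b)ᶜ = n - r := by
    rw [Fintype.card_compl_set, Fintype.card_fin, Set.card_range_of_injective hb, Fintype.card_fin]
  refine ⟨((Equiv.ofInjective b hb).sumCongr (Fintype.equivFinOfCardEq hcard).symm).trans
    (Equiv.Set.sumCompl (Set.range b)), ?_⟩
  ext i
  simp

/-- A matrix of rank `r` has a nonvanishing minor of size `r`. -/
theorem exists_det_submatrix_ne_zero {K : Type*} [Field K] {m n r : ℕ}
    {M : Matrix (Fin m) (Fin n) K} (h : M.rank = r) :
    ∃ (e : Fin r ⊕ Fin (n - r) ≃ Fin n) (I : Fin r → Fin m),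
      (M.submatrix I (e ∘ Sum.inl)).det ≠ 0 := by
  obtain ⟨I, hI⟩ := exists_linearIndependent_rows h
  have hrank : (M.submatrix I id)ᵀ.rank = r := by
    rw [Matrix.rank_transpose, LinearIndependent.rank_matrix hI, Fintype.card_fin]
  obtain ⟨b, hb⟩ := exists_linearIndependent_rows hrank
  have hinj : Function.Injective b := fun i j hij => hb.injective (by
    ext k
    simp [Matrix.row, hij])
  obtain ⟨e, rfl⟩ := exists_equiv_sum_comp_inl hinj
  refine ⟨e, I, ?_⟩
  have := (Matrix.linearIndependent_rows_iff_isUnit.1 hb)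
  rw [Matrix.isUnit_iff_isUnit_det, ← Matrix.det_transpose] at this
  exact this.ne_zero

/-- Let `A` be the square block of `M` with rows `I` and columns `e (inl _)`, and `B` the block with
the same rows and the other columns. By Cramer's rule the vectors `w` with `A w₁ + B w₂ = 0` are, if
`det A` is invertible, those with `w₁ = - adj A (B u)` and `w₂ = det A • u` for some `u`. The scaling
of `u` by `det A` makes this parametrization polynomial in the entries of `M` and `u`. -/
def kernelParam {R : Type*} [CommRing R] {m n r s : ℕ} (e : Fin r ⊕ Fin s ≃ Fin n)
    (I : Fin r → Fin m) (M : Matrix (Fin m) (Fin n) R) (u : Fin s → R) : Fin n → R := fun j =>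
  Sum.elim (-((M.submatrix I (e ∘ Sum.inl)).adjugate *ᵥ (M.submatrix I (e ∘ Sum.inr) *ᵥ u)))
    ((M.submatrix I (e ∘ Sum.inl)).det • u) (e.symm j)

theorem map_kernelParam {R R' : Type*} [CommRing R] [CommRing R'] (f : R →+* R') {m n r s : ℕ}
    (e : Fin r ⊕ Fin s ≃ Fin n) (I : Fin r → Fin m) (M : Matrix (Fin m) (Fin n) R)
    (u : Fin s → R) (j : Fin n) :
    f (kernelParam e I M u j) = kernelParam e I (M.map f) (f ∘ u) j := by
  unfold kernelParam
  cases e.symm j with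
  | inl i =>
    simp only [Sum.elim_inl, Pi.neg_apply, map_neg, RingHom.map_mulVec, Matrix.submatrix_map]
    congr 2
    rw [← RingHom.mapMatrix_apply, ← RingHom.mapMatrix_apply, RingHom.map_adjugate]
    ext k
    simp [RingHom.map_mulVec]
  | inr i =>
    simp [RingHom.map_det, RingHom.mapMatrix_apply, Matrix.submatrix_map]

theorem submatrix_mulVec_eq {R : Type*} [CommRing R] {m n r s : ℕ} (e : Fin r ⊕ Fin s ≃ Fin n)
    (I : Fin r → Fin m) (M : Matrix (Fin m) (Fin n) R) (w : Fin n → R) :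
    M.submatrix I id *ᵥ w = M.submatrix I (e ∘ Sum.inl) *ᵥ (w ∘ e ∘ Sum.inl) +
      M.submatrix I (e ∘ Sum.inr) *ᵥ (w ∘ e ∘ Sum.inr) := by
  ext i
  simp only [Matrix.mulVec, dotProduct, Pi.add_apply, Matrix.submatrix_apply, Function.comp_apply,
    id_eq]
  rw [← Fintype.sum_sum_type (fun k => M (I i) (e k) * w (e k))]
  exact (Equiv.sum_comp e fun j => M (I i) j * w j).symm

/-- The rows of a nonvanishing minor of maximal size span all rows, so that they alone determine the
kernel. -/
theorem mulVec_eq_zero_iff_submatrix {K : Type*} [Field K] {m n r : ℕ}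
    {M : Matrix (Fin m) (Fin n) K} (h : M.rank = r) {b : Fin r → Fin n} {I : Fin r → Fin m}
    (hdet : (M.submatrix I b).det ≠ 0) (w : Fin n → K) :
    M *ᵥ w = 0 ↔ M.submatrix I id *ᵥ w = 0 := by
  have hle : LinearMap.ker M.mulVecLin ≤ LinearMap.ker (M.submatrix I id).mulVecLin := fun w hw => by
    have hw' : M *ᵥ w = 0 := hw
    change M.submatrix I id *ᵥ w = 0
    ext i
    exact congrFun hw' (I i)
  have hrank : (M.submatrix I id).rank = r := by
    apply le_antisymm
    · exact (M.rank_submatrix_le I id).trans_eq h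
    · have h1 := (M.submatrix I id).rank_submatrix_le id b
      rw [Matrix.submatrix_submatrix, Function.comp_id, Function.id_comp,
        Matrix.rank_of_det_ne_zero hdet, Fintype.card_fin] at h1
      exact h1
  have heq := Submodule.eq_of_le_of_finrank_eq hle (by
    have h1 := LinearMap.finrank_range_add_finrank_ker M.mulVecLin
    have h2 := LinearMap.finrank_range_add_finrank_ker (M.submatrix I id).mulVecLin
    change M.rank + _ = _ at h1
    change (M.submatrix I id).rank + _ = _ at h2
    omega)
  exact SetLike.ext_iff.1 heq w

theorem mulVec_kernelParam {K : Type*} [Field K] {m n r s : ℕ} {M : Matrix (Fin m) (Fin n) K}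
    (h : M.rank = r) {e : Fin r ⊕ Fin s ≃ Fin n} {I : Fin r → Fin m}
    (hdet : (M.submatrix I (e ∘ Sum.inl)).det ≠ 0) (u : Fin s → K) :
    M *ᵥ kernelParam e I M u = 0 := by
  have h1 : kernelParam e I M u ∘ e ∘ Sum.inl = -((M.submatrix I (e ∘ Sum.inl)).adjugate *ᵥ
      (M.submatrix I (e ∘ Sum.inr) *ᵥ u)) := by
    ext i
    simp [kernelParam]
  have h2 : kernelParam e I M u ∘ e ∘ Sum.inr = (M.submatrix I (e ∘ Sum.inl)).det • u := by
    ext i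
    simp [kernelParam]
  rw [mulVec_eq_zero_iff_submatrix h hdet, submatrix_mulVec_eq e, h1, h2, Matrix.mulVec_neg,
    Matrix.mulVec_mulVec, Matrix.mul_adjugate, Matrix.smul_mulVec, Matrix.one_mulVec,
    Matrix.mulVec_smul, neg_add_cancel]

theorem exists_kernelParam_eq {K : Type*} [Field K] {m n r s : ℕ} {M : Matrix (Fin m) (Fin n) K}
    {e : Fin r ⊕ Fin s ≃ Fin n} {I : Fin r → Fin m}
    (hdet : (M.submatrix I (e ∘ Sum.inl)).det ≠ 0) {w : Fin n → K} (hw : M *ᵥ w = 0) :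
    ∃ u, kernelParam e I M u = w := by
  set A := M.submatrix I (e ∘ Sum.inl) with hA
  -- The parametrization scales the free coordinates by `A.det`.
  refine ⟨A.det⁻¹ • (w ∘ e ∘ Sum.inr), funext fun j => ?_⟩
  obtain ⟨k, rfl⟩ := e.surjective j
  cases k with
  | inl i =>
    have h0 : M.submatrix I id *ᵥ w = 0 := by
      ext i
      exact congrFun hw (I i)
    rw [submatrix_mulVec_eq e, add_comm, ← hA] at h0
    rw [kernelParam, Equiv.symm_apply_apply, Sum.elim_inl, ← hA, Matrix.mulVec_smul,
      eq_neg_of_add_eq_zero_left h0, Matrix.mulVec_smul, Matrix.mulVec_neg, Matrix.mulVec_mulVec,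
      Matrix.adjugate_mul, Matrix.smul_mulVec, Matrix.one_mulVec]
    simp [hdet]
  | inr i => simp [kernelParam, ← hA, hdet]

/-! ### Zeros over the rank loci -/

/-- The coordinates of a multilinear map are polynomial functions of its arguments. -/
theorem exists_eval_flatten_eq {K : Type*} [Field K] {ι : Type*} [Fintype ι] [DecidableEq ι]
    {n : ι → ℕ} (G : MultilinearMap K (fun i => Fin (n i) → K) K) :
    ∃ p : MvPolynomial (Σ i, Fin (n i)) K, ∀ v, eval (flatten v) p = G v := by
  refine ⟨∑ j : ∀ i, Fin (n i), (∏ i, X ⟨i, j i⟩) * C (G fun i => Pi.single (j i) 1), fun v => ?_⟩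
  have hv : v = fun i => ∑ k, v i k • (Pi.single k 1 : Fin (n i) → K) :=
    funext fun i => pi_eq_sum_univ' (v i)
  conv_rhs => rw [hv, MultilinearMap.map_sum]
  simp [flatten, MultilinearMap.map_smul_univ]

section

variable {K : Type*} [Field K] {d m : ℕ} {n : Fin (d + 1) → ℕ}

theorem exists_polynomial_toMatrix (F : MultilinearMap K (fun i => Fin (n i) → K) (Fin m → K)) :
    ∃ P : Matrix (Fin m) (Fin (n (Fin.last d)))
        (MvPolynomial (Σ i : Fin d, Fin (n i.castSucc)) K),
      ∀ v, P.map (eval (flatten v)) = LinearMap.toMatrix' (F.curryRight v) := by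
  have h : ∀ a b, ∃ p : MvPolynomial (Σ i : Fin d, Fin (n i.castSucc)) K,
      ∀ v, eval (flatten v) p = F.curryRight v (Pi.single b 1) a := fun a b =>
    exists_eval_flatten_eq
      ((LinearMap.proj a ∘ₗ LinearMap.applyₗ (Pi.single b 1)).compMultilinearMap F.curryRight)
  choose P hP using h
  refine ⟨Matrix.of P, fun v => ?_⟩
  ext a b
  rw [Matrix.map_apply, Matrix.of_apply, hP, LinearMap.toMatrix'_apply]

theorem rank_toMatrix' {p q : ℕ} (f : (Fin q → K) →ₗ[K] (Fin p → K)) :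
    (LinearMap.toMatrix' f).rank = Module.finrank K (LinearMap.range f) := by
  rw [Matrix.rank, ← Matrix.toLin'_apply', Matrix.toLin'_toMatrix']

/-- The tuples `v` for which `F(v, ·)` has rank `r` and the minor of its matrix with rows `I` and
columns `e (inl _)` does not vanish. -/
def rankPiece (F : MultilinearMap K (fun i => Fin (n i) → K) (Fin m → K)) {r s : ℕ}
    (e : Fin r ⊕ Fin s ≃ Fin (n (Fin.last d))) (I : Fin r → Fin m) :
    Set (∀ i : Fin d, Fin (n i.castSucc) → K) :=
  {v | (LinearMap.toMatrix' (F.curryRight v)).rank = r ∧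
    ((LinearMap.toMatrix' (F.curryRight v)).submatrix I (e ∘ Sum.inl)).det ≠ 0}

/-- The zeros of `F` lying over `rankPiece F e I`. -/
def zeroPiece (F : MultilinearMap K (fun i => Fin (n i) → K) (Fin m → K)) {r s : ℕ}
    (e : Fin r ⊕ Fin s ≃ Fin (n (Fin.last d))) (I : Fin r → Fin m) :
    Set (∀ i, Fin (n i) → K) :=
  {v | F v = 0 ∧ Fin.init v ∈ rankPiece F e I}

theorem snoc_mem_zeroPiece_iff {F : MultilinearMap K (fun i => Fin (n i) → K) (Fin m → K)}
    {r s : ℕ} {e : Fin r ⊕ Fin s ≃ Fin (n (Fin.last d))} {I : Fin r → Fin m}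
    {v : ∀ i : Fin d, Fin (n i.castSucc) → K} {w : Fin (n (Fin.last d)) → K} :
    (Fin.snoc v w : ∀ i, Fin (n i) → K) ∈ zeroPiece F e I ↔
      LinearMap.toMatrix' (F.curryRight v) *ᵥ w = 0 ∧ v ∈ rankPiece F e I := by
  rw [LinearMap.toMatrix'_mulVec, MultilinearMap.curryRight_apply, zeroPiece, Set.mem_ofPred_eq,
    Fin.init_snoc]

/-- Over a piece of the rank locus the zeros of `F` are in bijection with the product of the
piece with an affine space. Polynomial maps carry either of the two sets onto the other: forgetting
coordinates in one direction, `kernelParam` in the other. In general they are not mutually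
inverse, as the inverse of the projection has the minor as a denominator. -/
theorem pointsDim_zeroPiece [Infinite K]
    (F : MultilinearMap K (fun i => Fin (n i) → K) (Fin m → K)) {r s : ℕ}
    (e : Fin r ⊕ Fin s ≃ Fin (n (Fin.last d))) (I : Fin r → Fin m) :
    pointsDim (flatten '' zeroPiece F e I) = pointsDim (flatten '' rankPiece F e I) + s := by
  have hcyl := pointsDim_cylinder (ε := Fin s) (flatten '' rankPiece F e I)
  rw [Nat.card_fin] at hcyl
  rw [← hcyl]
  apply le_antisymm
  · obtain ⟨P, hP⟩ := exists_polynomial_toMatrix F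
    let φ : (Σ i, Fin (n i)) → MvPolynomial (Fin s ⊕ Σ i : Fin d, Fin (n i.castSucc)) K :=
      flatten (Fin.snoc (α := fun i => Fin (n i) → MvPolynomial _ K)
        (fun i j => X (Sum.inr ⟨i, j⟩))
        (kernelParam e I (P.map (rename Sum.inr)) fun k => X (Sum.inl k)))
    have hφ : ∀ (v : ∀ i : Fin d, Fin (n i.castSucc) → K) (u : Fin s → K),
        (fun p => eval (Sum.elim u (flatten v)) (φ p)) = flatten (Fin.snoc v
          (kernelParam e I (LinearMap.toMatrix' (F.curryRight v)) u) : ∀ i, Fin (n i) → K) := by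
      intro v u
      funext ⟨i, j⟩
      induction i using Fin.lastCases with
      | last =>
        have hmap : (P.map (rename Sum.inr)).map (eval (Sum.elim u (flatten v))) =
            LinearMap.toMatrix' (F.curryRight v) := by
          rw [← hP]
          ext a b
          simp [eval_rename]
        simp only [φ, flatten, Fin.snoc_last]
        rw [map_kernelParam]
        change kernelParam e I ((P.map (rename Sum.inr)).map (eval (Sum.elim u (flatten v)))) _ j = _
        rw [hmap]
        congr 1
        ext k
        simp
      | cast i => simp [φ, flatten]
    refine le_trans (pointsDim_mono ?_) (pointsDim_image_le _ φ)
    rintro _ ⟨v, hv, rfl⟩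
    rw [← Fin.snoc_init_self v, snoc_mem_zeroPiece_iff] at hv
    obtain ⟨u, hu⟩ := exists_kernelParam_eq hv.2.2 hv.1
    refine ⟨Sum.elim u (flatten (Fin.init v)), ?_, ?_⟩
    · exact ⟨Fin.init v, hv.2, rfl⟩
    · have h := hφ (Fin.init v) u
      rw [hu, Fin.snoc_init_self] at h
      exact h
  · let ψ : (Fin s ⊕ Σ i : Fin d, Fin (n i.castSucc)) → MvPolynomial (Σ i, Fin (n i)) K :=
      Sum.elim (fun k => X ⟨Fin.last d, e (Sum.inr k)⟩) fun p => X ⟨p.1.castSucc, p.2⟩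
    refine le_trans (pointsDim_mono ?_) (pointsDim_image_le _ ψ)
    rintro x ⟨v, hv, hvx⟩
    set M := LinearMap.toMatrix' (F.curryRight v) with hM
    set w := kernelParam e I M ((M.submatrix I (e ∘ Sum.inl)).det⁻¹ • (x ∘ Sum.inl)) with hw
    refine ⟨flatten (Fin.snoc v w : ∀ i, Fin (n i) → K), ⟨_, ?_, rfl⟩, ?_⟩
    · exact snoc_mem_zeroPiece_iff.2 ⟨mulVec_kernelParam hv.1 hv.2 _, hv⟩
    · funext k
      cases k with
      | inl k =>
        have hdet : (M.submatrix I (e ∘ Sum.inl)).det ≠ 0 := hv.2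
        simp [ψ, flatten, hw, kernelParam, hdet]
      | inr p =>
        have := congrFun hvx p
        simpa [ψ, flatten] using this

theorem exists_mem_rankPiece (F : MultilinearMap K (fun i => Fin (n i) → K) (Fin m → K)) {r : ℕ}
    {v : ∀ i : Fin d, Fin (n i.castSucc) → K}
    (hv : Module.finrank K (LinearMap.range (F.curryRight v)) = r) :
    ∃ (e : Fin r ⊕ Fin (n (Fin.last d) - r) ≃ Fin (n (Fin.last d))) (I : Fin r → Fin m),
      v ∈ rankPiece F e I := by
  rw [← rank_toMatrix'] at hv
  obtain ⟨e, I, h⟩ := exists_det_submatrix_ne_zero hv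
  exact ⟨e, I, hv, h⟩

theorem image_rankPiece_subset (F : MultilinearMap K (fun i => Fin (n i) → K) (Fin m → K))
    {r s : ℕ} (e : Fin r ⊕ Fin s ≃ Fin (n (Fin.last d))) (I : Fin r → Fin m) :
    flatten '' rankPiece F e I ⊆ rankSet F r :=
  Set.image_mono fun _ hv => (rank_toMatrix' _).symm.trans hv.1

theorem image_zeroPiece_subset (F : MultilinearMap K (fun i => Fin (n i) → K) (Fin m → K))
    {r s : ℕ} (e : Fin r ⊕ Fin s ≃ Fin (n (Fin.last d))) (I : Fin r → Fin m) :
    flatten '' zeroPiece F e I ⊆ zeroSet F :=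
  Set.image_mono fun _ hv => hv.1

/-- The indices `(e, I)` of the minors of size `r`. -/
abbrev MinorIndex (m N r : ℕ) : Type :=
  (Fin r ⊕ Fin (N - r) ≃ Fin N) × (Fin r → Fin m)

theorem nonempty_minorIndex {m N r : ℕ} (hr : r ≤ min N m) : Nonempty (MinorIndex m N r) :=
  ⟨finSumFinEquiv.trans (finCongr (by omega)), Fin.castLE (by omega)⟩

theorem pointsDim_rankSet_add_le [Infinite K]
    (F : MultilinearMap K (fun i => Fin (n i) → K) (Fin m → K)) {r : ℕ}
    (hr : r ≤ min (n (Fin.last d)) m) :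
    pointsDim (rankSet F r) + (n (Fin.last d) - r : ℕ) ≤ pointsDim (zeroSet F) := by
  have := nonempty_minorIndex hr
  obtain ⟨i, hi⟩ := exists_pointsDim_iUnion_le
    fun i : MinorIndex m (n (Fin.last d)) r => flatten '' rankPiece F i.1 i.2
  have hsub : rankSet F r ⊆
      ⋃ i : MinorIndex m (n (Fin.last d)) r, flatten '' rankPiece F i.1 i.2 := by
    rintro _ ⟨v, hv, rfl⟩
    obtain ⟨e, I, h⟩ := exists_mem_rankPiece F hv
    exact Set.mem_iUnion.2 ⟨(e, I), v, h, rfl⟩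
  calc _ ≤ pointsDim (flatten '' rankPiece F i.1 i.2) + (n (Fin.last d) - r : ℕ) := by
        gcongr
        exact (pointsDim_mono hsub).trans hi
    _ = pointsDim (flatten '' zeroPiece F i.1 i.2) := (pointsDim_zeroPiece F i.1 i.2).symm
    _ ≤ _ := pointsDim_mono (image_zeroPiece_subset F i.1 i.2)

theorem exists_pointsDim_zeroSet_le [Infinite K]
    (F : MultilinearMap K (fun i => Fin (n i) → K) (Fin m → K)) :
    ∃ r ≤ min (n (Fin.last d)) m,
      pointsDim (zeroSet F) ≤ pointsDim (rankSet F r) + (n (Fin.last d) - r : ℕ) := by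
  let ι := Σ r : Fin (min (n (Fin.last d)) m + 1), MinorIndex m (n (Fin.last d)) r
  have : Nonempty ι :=
    ⟨⟨0, (nonempty_minorIndex (Nat.zero_le _)).some⟩⟩
  obtain ⟨i, hi⟩ := exists_pointsDim_iUnion_le
    fun i : ι => flatten '' zeroPiece F i.2.1 i.2.2
  have hsub : zeroSet F ⊆ ⋃ i : ι, flatten '' zeroPiece F i.2.1 i.2.2 := by
    rintro _ ⟨v, hv, rfl⟩
    obtain ⟨e, I, h⟩ := exists_mem_rankPiece F (v := Fin.init v) rfl
    have hr : Module.finrank K (LinearMap.range (F.curryRight (Fin.init v))) ≤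
        min (n (Fin.last d)) m := by
      rw [← rank_toMatrix']
      exact le_min (Matrix.rank_le_width _) (Matrix.rank_le_height _)
    exact Set.mem_iUnion.2 ⟨⟨⟨_, Nat.lt_succ_of_le hr⟩, e, I⟩, v, ⟨hv, h⟩, rfl⟩
  refine ⟨i.1, Nat.le_of_lt_succ i.1.2, ?_⟩
  calc pointsDim (zeroSet F) ≤ pointsDim (flatten '' zeroPiece F i.2.1 i.2.2) :=
        (pointsDim_mono hsub).trans hi
    _ = pointsDim (flatten '' rankPiece F i.2.1 i.2.2) + (n (Fin.last d) - i.1 : ℕ) :=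
        pointsDim_zeroPiece F i.2.1 i.2.2
    _ ≤ _ := by
        gcongr
        exact pointsDim_mono (image_rankPiece_subset F i.2.1 i.2.2)

end

/-! ### From dimensions to codimensions -/

theorem le_codim_of_dim_le {σ τ L : Type*} [Fintype σ] [Fintype τ] [Field L] {Y : Set (σ → L)}
    {W : Set (τ → L)} {r N : ℕ} (hr : r ≤ N) (hcard : Fintype.card σ = Fintype.card τ + N)
    (h : dim Y ≤ dim W + (N - r : ℕ)) : r + codim W ≤ codim Y := by
  have hW := dim_le_card W
  unfold codim
  generalize dim Y = y at *
  generalize dim W = w at *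
  cases y with
  | bot => simp
  | coe y =>
    cases w with
    | bot => simp at h
    | coe w =>
      have hw : w ≤ (Fintype.card τ : ℕ∞) := WithBot.coe_le_coe.1 hW
      have h' : y ≤ w + (N - r : ℕ) := WithBot.coe_le_coe.1 h
      lift w to ℕ using ne_top_of_le_ne_top (ENat.natCast_ne_top _) hw
      lift y to ℕ using ne_top_of_le_ne_top (ENat.natCast_ne_top (w + (N - r))) (by exact_mod_cast h')
      change (r : ℕ∞) + ((Fintype.card τ : ℕ∞) - w) ≤ (Fintype.card σ : ℕ∞) - y
      norm_cast at *
      omega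

theorem codim_le_of_dim_le {σ τ L : Type*} [Fintype σ] [Fintype τ] [Field L] {Y : Set (σ → L)}
    {W : Set (τ → L)} {r N : ℕ} (hr : r ≤ N) (hcard : Fintype.card σ = Fintype.card τ + N)
    (h : dim W + (N - r : ℕ) ≤ dim Y) : codim Y ≤ r + codim W := by
  have hW := dim_le_card W
  have hY := dim_le_card Y
  unfold codim
  generalize dim Y = y at *
  generalize dim W = w at *
  cases w with
  | bot => simp
  | coe w =>
    cases y with
    | bot => simp at h
    | coe y =>
      have hw : w ≤ (Fintype.card τ : ℕ∞) := WithBot.coe_le_coe.1 hW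
      have hy : y ≤ (Fintype.card σ : ℕ∞) := WithBot.coe_le_coe.1 hY
      have h' : w + (N - r : ℕ) ≤ y := WithBot.coe_le_coe.1 h
      lift w to ℕ using ne_top_of_le_ne_top (ENat.natCast_ne_top _) hw
      lift y to ℕ using ne_top_of_le_ne_top (ENat.natCast_ne_top _) hy
      change (Fintype.card σ : ℕ∞) - y ≤ (r : ℕ∞) + ((Fintype.card τ : ℕ∞) - w)
      norm_cast at *
      omega

end MultilinearVariety

theorem mainTheorem3 {K : Type*} [Field K] [Infinite K] {d m : ℕ} (n : Fin (d + 1) → ℕ)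
    (F : MultilinearMap K (fun i => Fin (n i) → K) (Fin m → K)) :
    MultilinearVariety.codim
        (MultilinearVariety.closureOver (AlgebraicClosure K) (MultilinearVariety.zeroSet F)) =
      (Finset.Icc 0 (min (n (Fin.last d)) m)).inf' ⟨0, by simp⟩ (fun r : ℕ =>
        (r : ℕ∞) + MultilinearVariety.codim
          (MultilinearVariety.closureOver (AlgebraicClosure K)
            (MultilinearVariety.rankSet F r))) := by
  have hcard : Fintype.card (Σ i, Fin (n i)) =
      Fintype.card (Σ i : Fin d, Fin (n i.castSucc)) + n (Fin.last d) := by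
    simp [Fin.sum_univ_castSucc]
  apply le_antisymm
  · refine Finset.le_inf' _ _ fun r hr => ?_
    have hr' := (Finset.mem_Icc.1 hr).2
    refine MultilinearVariety.codim_le_of_dim_le (hr'.trans (min_le_left _ _)) hcard ?_
    rw [MultilinearVariety.dim_closureOver, MultilinearVariety.dim_closureOver]
    exact MultilinearVariety.pointsDim_rankSet_add_le F hr'
  · obtain ⟨r, hr, h⟩ := MultilinearVariety.exists_pointsDim_zeroSet_le F
    refine (Finset.inf'_le _ (Finset.mem_Icc.2 ⟨Nat.zero_le r, hr⟩)).trans ?_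
    refine MultilinearVariety.le_codim_of_dim_le (hr.trans (min_le_left _ _)) hcard ?_
    rw [MultilinearVariety.dim_closureOver, MultilinearVariety.dim_closureOver]
    exact h
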